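/- Let $Q$ be a discrete group and $P\subset Q$ a subsemigroup containing the identity $e$; write $m\le m'$ if $m'=mn$ for some $n\in P$. Assume that $P$ is quasi-lattice ordered, i.e. $P\cap P^{-1}=\{e\}$ and any two elements of $P$ with a common upper bound in $P$ have a least upper bound in $P$. Let $\Lambda$ be a topological $P$-graph. That is, $\Lambda$ is (the arrow space of) a small category with vertex space $\Lambda^{(0)}$, where $\Lambda$ and $\Lambda^{(0)}$ are locally compact Hausdorff spaces, the range and source maps $r,s:\Lambda\to\Lambda^{(0)}$ and the identity map $\Lambda^{(0)}\to\Lambda$ are continuous, $s$ is a local homeomorphism, and the composition $(\lambda,\mu)\mapsto\lambda\mu$, defined on $\Lambda^{(2)}=\{(\lambda,\mu)\in\Lambda\times\Lambda: s(\lambda)=r(\mu)\}$, is continuous and open; moreover there is a continuous map $d:\Lambda\to P$ ($P$ discrete) with $d(\mu\nu)=d(\mu)d(\nu)$ for $(\mu,\nu)\in\Lambda^{(2)}$ and $d(v)=e$ for every vertex $v$, such that, with $\Lambda^m=d^{-1}(m)$, for all $m,n\in P$ composition is a homeomorphism from $(\Lambda^m\times\Lambda^n)\cap\Lambda^{(2)}$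 onto $\Lambda^{mn}$. Assume that $\Lambda$ is $(r,d)$-proper, i.e. the map $(r,d):\Lambda\to\Lambda^{(0)}\times P$ is proper. For $\mu,\lambda\in\Lambda$ write $\mu\le\lambda$ if $\lambda=\mu\nu$ for some $\nu\in\Lambda$. A subset $A\subset\Lambda$ is hereditary if $\mu\le\lambda\in A$ implies $\mu\in A$, and directed if any two elements of $A$ have a common upper bound in $A$. Let $\Omega$ (the path space) be the set of all non-empty closed hereditary directed subsets of $\Lambda$, with the topology induced by the Fell topology on the closed subsets of $\Lambda$ (generated by the sets $\{F: F\cap K=\emptyset\}$, $K$ compact, and $\{F: F\cap U\neq\emptyset\}$, $U$ open). For $A\in\Omega$ and $n\in P$ put $$A\cdot n=\{\nu\in\Lambda:\ \mu\nu\in A\text{ for some }\mu\in\Lambda^n\text{ with } s(\mu)=r(\nu)\},\qquad \Omega*P=\{(A,n)\in\Omega\times P: A\cdot n\neq\emptyset\}.$$ **Theorem.** The space $\Omega$ is locally compact and Hausdorff, and the shift $T:(A,n)\mapsto A\cdot n$ is a well-defined map $\Omega*P\to\Omega$ which is a directed action of $P$ on $\Omega$ by partial local homeomorphisms. Explicitly,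 with $U(n)=\{A\in\Omega: (A,n)\in\Omega*P\}$ and $V(n)=\{A\cdot n: A\in U(n)\}$: 1. (Action) For all $A\in\Omega$, $(A,e)\in\Omega*P$ and $A\cdot e=A$. For all $A\in\Omega$ and $m,n\in P$, $(A,mn)\in\Omega*P$ if and only if $(A,m)\in\Omega*P$ and $(A\cdot m,n)\in\Omega*P$, and in this case $(A\cdot m)\cdot n=A\cdot(mn)$. 2. (Directed) For all $m,n\in P$ with $U(m)\cap U(n)\neq\emptyset$ there is an upper bound $r\in P$ of $m$ and $n$ such that $U(m)\cap U(n)=U(r)$. 3. (Partial local homeomorphisms) For every $n\in P$, $U(n)$ and $V(n)$ are open in $\Omega$ and $T_n:U(n)\to V(n)$, $A\mapsto A\cdot n$, is a local homeomorphism. -/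

import Mathlib

open Set Topology TopologicalSpace

/-! ## Semigroups -/

/-- The relation `m ≤ m'` on a semigroup with identity: there is `n` with `m' = m n`. -/
def SemigroupLE {P : Type*} [Monoid P] (m m' : P) : Prop := ∃ n : P, m' = m * n

/-- A subsemigroup `P ∋ e` of a group `Q` is quasi-lattice ordered if `P ∩ P⁻¹ = {e}` and any two
elements of `P` with a common upper bound in `P` have a least upper bound in `P`. -/
structure IsQuasiLatticeOrdered {Q : Type*} [Group Q] (P : Submonoid Q) : Prop where
  eq_one_of_inv_mem : ∀ m : Q, m ∈ P → m⁻¹ ∈ P → m = 1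
  exists_lub : ∀ m n : P, (∃ c : P, SemigroupLE m c ∧ SemigroupLE n c) →
    ∃ l : P, SemigroupLE m l ∧ SemigroupLE n l ∧
      ∀ c : P, SemigroupLE m c → SemigroupLE n c → SemigroupLE l c

/-! ## Partial semigroup actions -/

/-- A right (partial) action of a semigroup `P` with identity on a set `X`: a subset
`dom = X * P` of `X × P` and a map `act : X * P → X`, `(x, m) ↦ x · m`. -/
structure PartialSemigroupAction (X P : Type*) [Monoid P] where
  dom : Set (X × P)
  act : dom → X
  one_mem : ∀ x : X, (x, (1 : P)) ∈ dom
  act_one : ∀ x : X, act ⟨(x, 1), one_mem x⟩ = x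
  mul_mem_iff : ∀ (x : X) (m n : P),
    (x, m * n) ∈ dom ↔ ∃ h : (x, m) ∈ dom, (act ⟨(x, m), h⟩, n) ∈ dom
  act_mul : ∀ (x : X) (m n : P) (h : (x, m) ∈ dom) (h' : (act ⟨(x, m), h⟩, n) ∈ dom)
    (h'' : (x, m * n) ∈ dom), act ⟨(act ⟨(x, m), h⟩, n), h'⟩ = act ⟨(x, m * n), h''⟩

namespace PartialSemigroupAction

variable {X P : Type*} [Monoid P]

/-- The domain `U(m)` of `T_m`. -/
def U (T : PartialSemigroupAction X P) (m : P) : Set X := {x | (x, m) ∈ T.dom}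

/-- The map `T_m`, `x ↦ x · m`, on `U(m)`. -/
def map (T : PartialSemigroupAction X P) (m : P) (x : T.U m) : X := T.act ⟨(x.1, m), x.2⟩

/-- The range `V(m)` of `T_m`. -/
def V (T : PartialSemigroupAction X P) (m : P) : Set X := Set.range (T.map m)

/-- The action is directed: if `U(m) ∩ U(n)` is non-empty, then it equals `U(r)` for some upper
bound `r` of `m` and `n`. -/
def IsDirected (T : PartialSemigroupAction X P) : Prop :=
  ∀ m n : P, (T.U m ∩ T.U n).Nonempty →
    ∃ r : P, SemigroupLE m r ∧ SemigroupLE n r ∧ T.U m ∩ T.U n = T.U r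

/-- The action is by partial local homeomorphisms: every `U(m)` and `V(m)` is open in `X` and
`T_m : U(m) → V(m)` is a local homeomorphism. -/
structure ByPartialLocalHomeomorphisms [TopologicalSpace X] (T : PartialSemigroupAction X P) : Prop where
  isOpen_U : ∀ m : P, IsOpen (T.U m)
  isOpen_V : ∀ m : P, IsOpen (T.V m)
  isLocalHomeomorph : ∀ m : P,
    IsLocalHomeomorph (fun x : T.U m => (⟨T.map m x, x, rfl⟩ : T.V m))

end PartialSemigroupAction

/-! ## Topological higher-rank graphs -/

/-- A topological small category with space of vertices `Λ₀` and space of arrows `Λ` (both locally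
compact Hausdorff): range `r`, source `s`, identity map `i`, and composition `μ ν` defined on the
pairs with `s μ = r ν`. -/
structure TopologicalSmallCategory (Λ₀ Λ : Type*)
    [TopologicalSpace Λ₀] [LocallyCompactSpace Λ₀] [T2Space Λ₀]
    [TopologicalSpace Λ] [LocallyCompactSpace Λ] [T2Space Λ] where
  r : Λ → Λ₀
  s : Λ → Λ₀
  i : Λ₀ → Λ
  comp : {p : Λ × Λ // s p.1 = r p.2} → Λ
  r_i : ∀ v, r (i v) = v
  s_i : ∀ v, s (i v) = v
  r_comp : ∀ p, r (comp p) = r p.1.1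
  s_comp : ∀ p, s (comp p) = s p.1.2
  id_comp : ∀ a, comp ⟨(i (r a), a), s_i (r a)⟩ = a
  comp_id : ∀ a, comp ⟨(a, i (s a)), (r_i (s a)).symm⟩ = a
  assoc : ∀ (a b c : Λ) (hab : s a = r b) (hbc : s b = r c),
    comp ⟨(comp ⟨(a, b), hab⟩, c), (s_comp ⟨(a, b), hab⟩).trans hbc⟩ =
      comp ⟨(a, comp ⟨(b, c), hbc⟩), hab.trans (r_comp ⟨(b, c), hbc⟩).symm⟩
  continuous_r : Continuous r
  continuous_s : Continuous s
  isLocalHomeomorph_s : IsLocalHomeomorph s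
  continuous_i : Continuous i
  continuous_comp : Continuous comp
  isOpenMap_comp : IsOpenMap comp

/-- A `P`-graph (higher-rank topological graph graded by `P`), where `P` is discrete. -/
structure PGraph (P Λ₀ Λ : Type*) [Monoid P] [TopologicalSpace P] [DiscreteTopology P]
    [TopologicalSpace Λ₀] [LocallyCompactSpace Λ₀] [T2Space Λ₀]
    [TopologicalSpace Λ] [LocallyCompactSpace Λ] [T2Space Λ]
    extends TopologicalSmallCategory Λ₀ Λ where
  /-- the degree map -/
  d : Λ → P
  continuous_d : Continuous d
  d_comp : ∀ p, d (comp p) = d p.1.1 * d p.1.2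
  d_i : ∀ v, d (i v) = 1
  /-- unique factorization: composition is a homeomorphism `Λ^m * Λ^n → Λ^{mn}` -/
  factorization : ∀ m n : P,
    IsHomeomorph (fun p : {p : Λ × Λ // s p.1 = r p.2 ∧ d p.1 = m ∧ d p.2 = n} =>
      (⟨comp ⟨p.1, p.2.1⟩, (d_comp _).trans (congrArg₂ (· * ·) p.2.2.1 p.2.2.2)⟩ : {a : Λ // d a = m * n}))

/-- The Fell topology on the closed subsets of `X`, generated by the sets
`{F | F ∩ K = ∅}` with `K` compact and `{F | F ∩ U ≠ ∅}` with `U` open. -/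
@[reducible] def fellTopology (X : Type*) [TopologicalSpace X] : TopologicalSpace (Closeds X) :=
  generateFrom
    ({S | ∃ K : Set X, IsCompact K ∧ S = {F : Closeds X | (F : Set X) ∩ K = ∅}} ∪
      {S | ∃ U : Set X, IsOpen U ∧ S = {F : Closeds X | ((F : Set X) ∩ U).Nonempty}})

namespace PGraph

variable {P Λ₀ Λ : Type*} [Monoid P] [TopologicalSpace P] [DiscreteTopology P]
  [TopologicalSpace Λ₀] [LocallyCompactSpace Λ₀] [T2Space Λ₀]
  [TopologicalSpace Λ] [LocallyCompactSpace Λ] [T2Space Λ]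

/-- `(r, d)`-properness: the map `(r, d) : Λ → Λ₀ × P` is proper. -/
def IsRDProper (G : PGraph P Λ₀ Λ) : Prop := IsProperMap (fun a : Λ => (G.r a, G.d a))

/-- The pre-order on `Λ`: `a ≤ b` if `b = a c` for some `c`. -/
def PathLE (G : PGraph P Λ₀ Λ) (a b : Λ) : Prop :=
  ∃ (c : Λ) (h : G.s a = G.r c), b = G.comp ⟨(a, c), h⟩

def IsHereditary (G : PGraph P Λ₀ Λ) (A : Set Λ) : Prop :=
  ∀ a b : Λ, G.PathLE a b → b ∈ A → a ∈ A

def IsDirectedSet (G : PGraph P Λ₀ Λ) (A : Set Λ) : Prop :=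
  ∀ a ∈ A, ∀ b ∈ A, ∃ c ∈ A, G.PathLE a c ∧ G.PathLE b c

/-- The path space `Ω`: all non-empty hereditary directed closed subsets of `Λ`. -/
def PathSpace (G : PGraph P Λ₀ Λ) : Type _ :=
  {A : Closeds Λ // (A : Set Λ).Nonempty ∧ G.IsHereditary A ∧ G.IsDirectedSet A}

/-- The closed subset of `Λ` underlying a point of `Ω`. -/
def PathSpace.toCloseds {G : PGraph P Λ₀ Λ} (A : G.PathSpace) : Closeds Λ := A.1

/-- `Ω` is topologized as a subspace of the closed subsets of `Λ` with the Fell topology. -/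
instance (G : PGraph P Λ₀ Λ) : TopologicalSpace G.PathSpace :=
  (fellTopology Λ).induced PathSpace.toCloseds

/-- `A · n = {ν | μ ν ∈ A for some μ of degree n}`. -/
def shift (G : PGraph P Λ₀ Λ) (A : Set Λ) (n : P) : Set Λ :=
  {b | ∃ (a : Λ) (h : G.s a = G.r b), G.d a = n ∧ G.comp ⟨(a, b), h⟩ ∈ A}

end PGraph

/-! Unique factorization makes a directed set contain at most one path of each degree, and since
degree fibres are open, such a set is automatically closed. A point `A` of the path space is thus a
coherent family of paths, and `A ∈ U(n)` exactly when `A` has an element of degree `n`. The action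
laws and directedness are then algebra: `U(m) ∩ U(n)` is `U` of the least upper bound.

All closed subsets form a compact space in the Fell topology, Hausdorff because `Λ` is locally
compact. Hereditary directed closed sets, the empty one included, form a closed subspace
(`isClosed_hereditary_directed`): properness supplies a path of the least upper bound degree in a
limit. Discarding the empty set is an open condition, so the path space is locally compact.

For the local homeomorphisms, prepending a path `a` inverts the shift by `d a` on sets containing
`a`. Continuity of prepending, jointly in the path and the set (`continuous_prepend`), is the hard
point; it makes the shift open. Local injectivity holds because `s` is locally injective and the
shifted set remembers `s a`. -/

namespace PGraph

variable {P Λ₀ Λ : Type*} [Monoid P] [TopologicalSpace P] [DiscreteTopology P]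
  [TopologicalSpace Λ₀] [LocallyCompactSpace Λ₀] [T2Space Λ₀]
  [TopologicalSpace Λ] [LocallyCompactSpace Λ] [T2Space Λ] {G : PGraph P Λ₀ Λ}

/-! ## Algebra of paths -/

/-- The relation saying that `a` and `b` are composable, with composite `c`. -/
def IsComp (G : PGraph P Λ₀ Λ) (a b c : Λ) : Prop :=
  ∃ h : G.s a = G.r b, G.comp ⟨(a, b), h⟩ = c

theorem pathLE_iff {a b : Λ} : G.PathLE a b ↔ ∃ c, G.IsComp a c b :=
  exists_congr fun _ => exists_congr fun _ => eq_comm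

theorem mem_shift_iff {A : Set Λ} {n : P} {b : Λ} :
    b ∈ G.shift A n ↔ ∃ a c, G.IsComp a b c ∧ G.d a = n ∧ c ∈ A := by
  constructor
  · rintro ⟨a, h, hd, hA⟩
    exact ⟨a, _, ⟨h, rfl⟩, hd, hA⟩
  · rintro ⟨a, _, ⟨h, rfl⟩, hd, hA⟩
    exact ⟨a, h, hd, hA⟩

theorem exists_isComp {a b : Λ} (h : G.s a = G.r b) : ∃ c, G.IsComp a b c := ⟨_, h, rfl⟩

theorem isComp_id_left (a : Λ) : G.IsComp (G.i (G.r a)) a a := ⟨_, G.id_comp a⟩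

theorem isComp_id_right (a : Λ) : G.IsComp a (G.i (G.s a)) a := ⟨_, G.comp_id a⟩

namespace IsComp

variable {a b c a' b' c' x y : Λ}

theorem unique (h : G.IsComp a b c) (h' : G.IsComp a b c') : c = c' := by
  obtain ⟨_, rfl⟩ := h
  obtain ⟨_, rfl⟩ := h'
  rfl

theorem s_eq_r (h : G.IsComp a b c) : G.s a = G.r b := h.1

theorem r_eq (h : G.IsComp a b c) : G.r c = G.r a := by
  obtain ⟨h, rfl⟩ := h
  exact G.r_comp _

theorem d_eq (h : G.IsComp a b c) : G.d c = G.d a * G.d b := by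
  obtain ⟨h, rfl⟩ := h
  exact G.d_comp _

theorem assoc (h : G.IsComp a b x) (h' : G.IsComp x c y) :
    ∃ z, G.IsComp b c z ∧ G.IsComp a z y := by
  obtain ⟨h, rfl⟩ := h
  obtain ⟨h', rfl⟩ := h'
  have hbc : G.s b = G.r c := (G.s_comp _).symm.trans h'
  exact ⟨_, ⟨hbc, rfl⟩, _, (G.assoc a b c h hbc).symm⟩

theorem assoc' (h : G.IsComp b c x) (h' : G.IsComp a x y) :
    ∃ z, G.IsComp a b z ∧ G.IsComp z c y := by
  obtain ⟨h, rfl⟩ := h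
  obtain ⟨h', rfl⟩ := h'
  have hab : G.s a = G.r b := h'.trans (G.r_comp _)
  exact ⟨_, ⟨hab, rfl⟩, _, G.assoc a b c hab h⟩

theorem pathLE (h : G.IsComp a b c) : G.PathLE a c := pathLE_iff.2 ⟨b, h⟩

/-- Cancellation in `P` forces the second factors to have equal degree too, so both pairs lie in one
domain on which composition is injective. -/
theorem factor_unique [IsLeftCancelMul P] (h : G.IsComp a b c) (h' : G.IsComp a' b' c)
    (hd : G.d a = G.d a') : a = a' ∧ b = b' := by
  have hb : G.d b = G.d b' := by
    have := h.d_eq.symm.trans h'.d_eq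
    rw [hd] at this
    exact mul_left_cancel this
  obtain ⟨h1, hc⟩ := h
  obtain ⟨h2, hc'⟩ := h'
  have := (G.factorization (G.d a') (G.d b')).bijective.1
    (a₁ := ⟨(a, b), h1, hd, hb⟩) (a₂ := ⟨(a', b'), h2, rfl, rfl⟩)
    (Subtype.ext (hc.trans hc'.symm))
  simpa using this

theorem left_cancel [IsLeftCancelMul P] (h : G.IsComp a b c) (h' : G.IsComp a b' c) : b = b' :=
  (h.factor_unique h' rfl).2

end IsComp

theorem exists_factorization {c : Λ} {m n : P} (h : G.d c = m * n) :
    ∃ a b, G.IsComp a b c ∧ G.d a = m ∧ G.d b = n := by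
  obtain ⟨⟨p, h1, h2, h3⟩, hp⟩ := (G.factorization m n).bijective.2 ⟨c, h⟩
  exact ⟨p.1, p.2, ⟨h1, congrArg Subtype.val hp⟩, h2, h3⟩

namespace PathLE

variable {a b c : Λ}

theorem refl (a : Λ) : G.PathLE a a := (isComp_id_right a).pathLE

theorem trans (h : G.PathLE a b) (h' : G.PathLE b c) : G.PathLE a c := by
  obtain ⟨x, hx⟩ := pathLE_iff.1 h
  obtain ⟨y, hy⟩ := pathLE_iff.1 h'
  obtain ⟨z, -, hz⟩ := hx.assoc hy
  exact hz.pathLE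

theorem r_eq (h : G.PathLE a b) : G.r b = G.r a := by
  obtain ⟨x, hx⟩ := pathLE_iff.1 h
  exact hx.r_eq

theorem d_le (h : G.PathLE a b) : SemigroupLE (G.d a) (G.d b) := by
  obtain ⟨x, hx⟩ := pathLE_iff.1 h
  exact ⟨_, hx.d_eq⟩

theorem eq_of_d_eq [IsLeftCancelMul P] (h : G.PathLE a c) (h' : G.PathLE b c)
    (hd : G.d a = G.d b) : a = b := by
  obtain ⟨x, hx⟩ := pathLE_iff.1 h
  obtain ⟨y, hy⟩ := pathLE_iff.1 h'
  exact (hx.factor_unique hy hd).1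

/-- Below a fixed path the order is the order of degrees: the initial piece of `b` of degree `d a`
is also initial in `c`, hence equals `a`. -/
theorem of_d_le [IsLeftCancelMul P] (h : G.PathLE a c) (h' : G.PathLE b c)
    (hd : SemigroupLE (G.d a) (G.d b)) : G.PathLE a b := by
  obtain ⟨n, hn⟩ := hd
  obtain ⟨x, y, hxy, hx, -⟩ := exists_factorization hn
  obtain rfl : a = x := h.eq_of_d_eq (hxy.pathLE.trans h') hx.symm
  exact hxy.pathLE

end PathLE

theorem exists_pathLE_of_d_le {c : Λ} {m : P} (h : SemigroupLE m (G.d c)) :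
    ∃ a, G.PathLE a c ∧ G.d a = m := by
  obtain ⟨n, hn⟩ := h
  obtain ⟨a, b, hab, ha, -⟩ := exists_factorization hn
  exact ⟨a, hab.pathLE, ha⟩

theorem isComp_pathLE_iff [IsLeftCancelMul P] {a b b' c c' : Λ} (h : G.IsComp a b c)
    (h' : G.IsComp a b' c') : G.PathLE c c' ↔ G.PathLE b b' := by
  rw [pathLE_iff, pathLE_iff]
  constructor
  · rintro ⟨x, hx⟩
    obtain ⟨z, hz, hz'⟩ := h.assoc hx
    obtain rfl := hz'.left_cancel h'
    exact ⟨x, hz⟩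
  · rintro ⟨x, hx⟩
    obtain ⟨z, hz, hz'⟩ := hx.assoc' h'
    obtain rfl := hz.unique h
    exact ⟨x, hz'⟩

theorem eq_id_of_d_eq_one [IsLeftCancelMul P] {a : Λ} (h : G.d a = 1) : a = G.i (G.r a) :=
  ((isComp_id_right a).factor_unique (isComp_id_left a) (by rw [h, G.d_i])).1

/-! ## Hereditary and directed sets -/

section Sets

variable {A : Set Λ}

theorem IsDirectedSet.eq_of_d_eq [IsLeftCancelMul P] (hA : G.IsDirectedSet A) {a b : Λ}
    (ha : a ∈ A) (hb : b ∈ A) (h : G.d a = G.d b) : a = b := by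
  obtain ⟨c, -, hac, hbc⟩ := hA a ha b hb
  exact hac.eq_of_d_eq hbc h

theorem IsDirectedSet.r_eq (hA : G.IsDirectedSet A) {a b : Λ}
    (ha : a ∈ A) (hb : b ∈ A) : G.r a = G.r b := by
  obtain ⟨c, -, hac, hbc⟩ := hA a ha b hb
  rw [← hac.r_eq, ← hbc.r_eq]

/-- Each open degree fibre meets `A` in at most one point. Closedness of shifted and prepended sets
therefore comes for free. -/
theorem IsDirectedSet.isClosed [IsLeftCancelMul P] (hA : G.IsDirectedSet A) : IsClosed A := by
  rw [← isOpen_compl_iff, isOpen_iff_mem_nhds]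
  intro x hx
  have hs : IsClosed (A ∩ {a | G.d a = G.d x}) :=
    Set.Subsingleton.isClosed fun a ha b hb =>
      hA.eq_of_d_eq ha.1 hb.1 (ha.2.trans hb.2.symm)
  have hd : IsOpen {a | G.d a = G.d x} := (isOpen_discrete {G.d x}).preimage G.continuous_d
  filter_upwards [hs.isOpen_compl.mem_nhds fun h => hx h.1, hd.mem_nhds rfl] with y hy hy' h
  exact hy ⟨h, hy'⟩

theorem IsHereditary.id_mem (hA : G.IsHereditary A) {a : Λ} (ha : a ∈ A) : G.i (G.r a) ∈ A :=
  hA _ _ (isComp_id_left a).pathLE ha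

theorem IsHereditary.shift_nonempty_iff (hA : G.IsHereditary A) {n : P} :
    (G.shift A n).Nonempty ↔ ∃ a ∈ A, G.d a = n := by
  constructor
  · rintro ⟨b, hb⟩
    obtain ⟨a, c, h, hd, hc⟩ := mem_shift_iff.1 hb
    exact ⟨a, hA _ _ h.pathLE hc, hd⟩
  · rintro ⟨a, ha, hd⟩
    exact ⟨_, mem_shift_iff.2 ⟨a, a, isComp_id_right a, hd, ha⟩⟩

theorem IsHereditary.shift (hA : G.IsHereditary A) (n : P) : G.IsHereditary (G.shift A n) := by
  intro b c hbc hc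
  obtain ⟨a, x, hx, hd, hxA⟩ := mem_shift_iff.1 hc
  obtain ⟨y, hy⟩ := pathLE_iff.1 hbc
  obtain ⟨z, hz, hz'⟩ := hy.assoc' hx
  exact mem_shift_iff.2 ⟨a, z, hz, hd, hA _ _ hz'.pathLE hxA⟩

/-- In a hereditary directed set the initial path of the shift is determined by its degree. -/
theorem mem_shift_iff_of_mem [IsLeftCancelMul P] (hA : G.IsHereditary A)
    (hA' : G.IsDirectedSet A) {a b : Λ} (ha : a ∈ A) :
    b ∈ G.shift A (G.d a) ↔ ∃ c ∈ A, G.IsComp a b c := by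
  rw [mem_shift_iff]
  constructor
  · rintro ⟨a', c, h, hd, hc⟩
    obtain rfl : a' = a := hA'.eq_of_d_eq (hA _ _ h.pathLE hc) ha hd
    exact ⟨c, hc, h⟩
  · rintro ⟨c, hc, h⟩
    exact ⟨a, c, h, rfl, hc⟩

theorem IsDirectedSet.shift [IsLeftCancelMul P] (hA : G.IsHereditary A) (hA' : G.IsDirectedSet A)
    (n : P) : G.IsDirectedSet (G.shift A n) := by
  intro b hb c hc
  obtain ⟨a, ha, rfl⟩ := hA.shift_nonempty_iff.1 ⟨b, hb⟩
  simp only [mem_shift_iff_of_mem hA hA' ha] at hb hc ⊢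
  obtain ⟨x, hxA, hx⟩ := hb
  obtain ⟨y, hyA, hy⟩ := hc
  obtain ⟨z, hzA, hxz, hyz⟩ := hA' x hxA y hyA
  obtain ⟨w, hw⟩ := pathLE_iff.1 (hx.pathLE.trans hxz)
  exact ⟨w, ⟨z, hzA, hw⟩, (isComp_pathLE_iff hx hw).1 hxz, (isComp_pathLE_iff hy hw).1 hyz⟩

theorem shift_one [IsLeftCancelMul P] (A : Set Λ) : G.shift A 1 = A := by
  ext b
  rw [mem_shift_iff]
  constructor
  · rintro ⟨a, c, h, hd, hc⟩
    have ha := eq_id_of_d_eq_one hd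
    have hr : G.r a = G.r b := by rw [← h.s_eq_r, ha, G.s_i, G.r_i]
    rw [ha, hr] at h
    rwa [(isComp_id_left b).unique h]
  · intro hb
    exact ⟨_, b, isComp_id_left b, G.d_i _, hb⟩

theorem shift_shift (m n : P) : G.shift (G.shift A m) n = G.shift A (m * n) := by
  ext b
  simp only [mem_shift_iff]
  constructor
  · rintro ⟨a, c, h, rfl, a', c', h', rfl, hA⟩
    obtain ⟨z, hz, hz'⟩ := h.assoc' h'
    exact ⟨z, c', hz', hz.d_eq, hA⟩
  · rintro ⟨a, c, h, hd, hA⟩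
    obtain ⟨x, y, hxy, hx, hy⟩ := exists_factorization hd
    obtain ⟨z, hz, hz'⟩ := hxy.assoc h
    exact ⟨y, z, hz, hy, x, c, hz', hx, hA⟩

/-! ### Prepending a path, inverse to the shift -/

/-- The hereditary set generated by the composites of `a` with the elements of `B`. -/
def prepend (G : PGraph P Λ₀ Λ) (a : Λ) (B : Set Λ) : Set Λ :=
  {x | ∃ b ∈ B, ∃ c, G.IsComp a b c ∧ G.PathLE x c}

theorem isHereditary_prepend (a : Λ) (B : Set Λ) : G.IsHereditary (G.prepend a B) := by
  rintro x y hxy ⟨b, hb, c, hc, hyc⟩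
  exact ⟨b, hb, c, hc, hxy.trans hyc⟩

theorem isDirectedSet_prepend [IsLeftCancelMul P] (a : Λ) {B : Set Λ} (hB : G.IsDirectedSet B) :
    G.IsDirectedSet (G.prepend a B) := by
  rintro x ⟨b, hb, c, hc, hxc⟩ x' ⟨b', hb', c', hc', hxc'⟩
  obtain ⟨z, hz, hbz, hbz'⟩ := hB b hb b' hb'
  obtain ⟨w, hw⟩ := exists_isComp (hc.s_eq_r.trans hbz.r_eq.symm)
  exact ⟨w, ⟨z, hz, w, hw, PathLE.refl w⟩, hxc.trans ((isComp_pathLE_iff hc hw).2 hbz),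
    hxc'.trans ((isComp_pathLE_iff hc' hw).2 hbz')⟩

theorem mem_prepend_self {a : Λ} {B : Set Λ} (h : G.i (G.s a) ∈ B) : a ∈ G.prepend a B :=
  ⟨_, h, a, isComp_id_right a, PathLE.refl a⟩

theorem shift_prepend [IsLeftCancelMul P] {a : Λ} {B : Set Λ} (hB : G.IsHereditary B)
    (hB' : G.IsDirectedSet B) (h : G.i (G.s a) ∈ B) : G.shift (G.prepend a B) (G.d a) = B := by
  ext b
  rw [mem_shift_iff_of_mem (isHereditary_prepend a B) (isDirectedSet_prepend a hB')
    (mem_prepend_self h)]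
  constructor
  · rintro ⟨c, ⟨b', hb', c', hc', hcc'⟩, hc⟩
    exact hB _ _ ((isComp_pathLE_iff hc hc').1 hcc') hb'
  · intro hb
    have := hB'.r_eq h hb
    rw [G.r_i] at this
    obtain ⟨c, hc⟩ := exists_isComp this
    exact ⟨c, ⟨b, hb, c, hc, PathLE.refl c⟩, hc⟩

theorem prepend_shift [IsLeftCancelMul P] (hA : G.IsHereditary A) (hA' : G.IsDirectedSet A)
    {a : Λ} (ha : a ∈ A) : G.prepend a (G.shift A (G.d a)) = A := by
  ext x
  constructor
  · rintro ⟨b, hb, c, hc, hxc⟩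
    obtain ⟨c', hc', h⟩ := (mem_shift_iff_of_mem hA hA' ha).1 hb
    obtain rfl := hc.unique h
    exact hA _ _ hxc hc'
  · intro hx
    obtain ⟨c, hc, hac, hxc⟩ := hA' a ha x hx
    obtain ⟨b, hb⟩ := pathLE_iff.1 hac
    exact ⟨b, (mem_shift_iff_of_mem hA hA' ha).2 ⟨c, hc, hb⟩, c, hb, hxc⟩

theorem id_mem_shift [IsLeftCancelMul P] (hA : G.IsHereditary A) (hA' : G.IsDirectedSet A)
    {a : Λ} (ha : a ∈ A) : G.i (G.s a) ∈ G.shift A (G.d a) :=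
  (mem_shift_iff_of_mem hA hA' ha).2 ⟨a, ha, isComp_id_right a⟩

end Sets

end PGraph

/-! ## The Fell topology -/

section Fell

variable {X : Type*} [TopologicalSpace X]

theorem isOpen_fell_disjoint {K : Set X} (hK : IsCompact K) :
    IsOpen[fellTopology X] {F : Closeds X | (F : Set X) ∩ K = ∅} :=
  isOpen_generateFrom_of_mem (Or.inl ⟨K, hK, rfl⟩)

theorem isOpen_fell_meets {U : Set X} (hU : IsOpen U) :
    IsOpen[fellTopology X] {F : Closeds X | ((F : Set X) ∩ U).Nonempty} :=
  isOpen_generateFrom_of_mem (Or.inr ⟨U, hU, rfl⟩)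

/-- An ultrafilter `𝓤` of closed sets converges to the set of points all of whose open
neighbourhoods are met by `𝓤`-almost every closed set. Missing a compact set passes from the limit
to `𝓤` by a finite cover. -/
theorem fellTopology_compactSpace (X : Type*) [TopologicalSpace X] :
    @CompactSpace (Closeds X) (fellTopology X) := by
  let := fellTopology X
  refine ⟨isCompact_iff_ultrafilter_le_nhds.2 fun 𝓤 _ => ?_⟩
  let F : Closeds X := ⟨{x | ∀ U, IsOpen U → x ∈ U →
    {F : Closeds X | ((F : Set X) ∩ U).Nonempty} ∈ 𝓤}, by
      rw [← isOpen_compl_iff, isOpen_iff_forall_mem_open]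
      intro x hx
      simp only [mem_compl_iff, mem_ofPred_eq, not_forall] at hx
      obtain ⟨U, hU, hxU, h⟩ := hx
      exact ⟨U, fun y hy hy' => h (hy' U hU hy), hU, hxU⟩⟩
  refine ⟨F, mem_univ _, ?_⟩
  rw [nhds_generateFrom]
  refine le_iInf₂ fun S hS => Filter.le_principal_iff.2 ?_
  obtain ⟨hFS, ⟨K, hK, rfl⟩ | ⟨U, hU, rfl⟩⟩ := hS
  · have key : ∀ x ∈ K, ∃ t ∈ 𝓝[K] x, {F : Closeds X | (F : Set X) ∩ t = ∅} ∈ 𝓤 := by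
      intro x hx
      have hxF : x ∉ F := fun h => (Set.ext_iff.1 hFS x).1 ⟨h, hx⟩
      have hxF' : ¬ ∀ U, IsOpen U → x ∈ U →
        {F : Closeds X | ((F : Set X) ∩ U).Nonempty} ∈ 𝓤 := hxF
      push Not at hxF'
      obtain ⟨U, hU, hxU, h⟩ := hxF'
      refine ⟨U, mem_nhdsWithin_of_mem_nhds (hU.mem_nhds hxU), ?_⟩
      filter_upwards [Ultrafilter.compl_mem_iff_notMem.2 h] with F' hF'
      exact not_nonempty_iff_eq_empty.1 hF'
    refine hK.induction_on (p := fun t => {F : Closeds X | (F : Set X) ∩ t = ∅} ∈ 𝓤)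
      ?_ ?_ ?_ key
    · filter_upwards with F' using inter_empty _
    · intro s t hst ht
      filter_upwards [ht] with F' hF'
      exact subset_empty_iff.1 ((inter_subset_inter_right _ hst).trans hF'.subset)
    · intro s t hs ht
      filter_upwards [hs, ht] with F' h1 h2
      rw [inter_union_distrib_left, h1, h2, union_empty]
  · obtain ⟨x, hxF, hxU⟩ := hFS
    exact hxF U hU hxU

/-- A point of `F` outside `F'` has a compact neighbourhood `K` missing `F'`; meeting the interior
of `K` and missing `K` are disjoint open conditions. -/
theorem fellTopology_t2Space (X : Type*) [TopologicalSpace X] [LocallyCompactSpace X] :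
    @T2Space (Closeds X) (fellTopology X) := by
  let := fellTopology X
  have key : ∀ F F' : Closeds X, ¬ (F : Set X) ⊆ F' → SeparatedNhds {F} {F'} := by
    intro F F' h
    obtain ⟨x, hx, hx'⟩ := not_subset.1 h
    obtain ⟨K, hK, hxK, hKF⟩ := exists_compact_subset F'.isClosed.isOpen_compl hx'
    refine ⟨_, _, isOpen_fell_meets isOpen_interior, isOpen_fell_disjoint hK,
      singleton_subset_iff.2 ⟨x, hx, hxK⟩, singleton_subset_iff.2 ?_, ?_⟩
    · exact (disjoint_compl_right.mono_right hKF).inter_eq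
    · rw [Set.disjoint_left]
      rintro E ⟨y, hy, hyK⟩ hE
      exact (Set.ext_iff.1 hE y).1 ⟨hy, interior_subset hyK⟩
  refine ⟨fun F F' hne => ?_⟩
  have : ¬ (F : Set X) ⊆ F' ∨ ¬ (F' : Set X) ⊆ F := by
    by_contra! h
    exact hne (SetLike.coe_injective (h.1.antisymm h.2))
  have hsep : SeparatedNhds {F} {F'} := this.elim (key F F') fun h => (key F' F h).symm
  obtain ⟨u, v, hu, hv, hFu, hFv, huv⟩ := hsep
  exact ⟨u, v, hu, hv, hFu rfl, hFv rfl, huv⟩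

end Fell

/-- Any two elements of `P` with a common upper bound have a least upper bound. -/
def HasSemigroupLubs (P : Type*) [Monoid P] : Prop :=
  ∀ m n : P, (∃ c : P, SemigroupLE m c ∧ SemigroupLE n c) →
    ∃ l : P, SemigroupLE m l ∧ SemigroupLE n l ∧
      ∀ c : P, SemigroupLE m c → SemigroupLE n c → SemigroupLE l c

namespace PGraph

variable {P Λ₀ Λ : Type*} [Monoid P] [TopologicalSpace P] [DiscreteTopology P]
  [TopologicalSpace Λ₀] [LocallyCompactSpace Λ₀] [T2Space Λ₀]
  [TopologicalSpace Λ] [LocallyCompactSpace Λ] [T2Space Λ] {G : PGraph P Λ₀ Λ}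

/-! ## Topology of paths -/

theorem isOpen_degree (n : P) : IsOpen {a | G.d a = n} :=
  (isOpen_discrete {n}).preimage G.continuous_d

theorem isOpen_isComp {U V : Set Λ} (hU : IsOpen U) (hV : IsOpen V) :
    IsOpen {c | ∃ a ∈ U, ∃ b ∈ V, G.IsComp a b c} := by
  convert G.isOpenMap_comp _ ((hU.prod hV).preimage continuous_subtype_val) using 1
  ext c
  constructor
  · rintro ⟨a, ha, b, hb, h, rfl⟩
    exact ⟨_, ⟨ha, hb⟩, rfl⟩
  · rintro ⟨⟨p, h⟩, hp, rfl⟩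
    exact ⟨p.1, hp.1, p.2, hp.2, h, rfl⟩

theorem isOpen_extensions {U : Set Λ} (hU : IsOpen U) :
    IsOpen {c | ∃ a ∈ U, G.PathLE a c} := by
  convert G.isOpen_isComp hU isOpen_univ using 1
  simp [pathLE_iff]

theorem isClosed_composable : IsClosed {p : Λ × Λ | G.s p.1 = G.r p.2} :=
  isClosed_eq (G.continuous_s.comp continuous_fst) (G.continuous_r.comp continuous_snd)

theorem isCompact_composable {C D : Set Λ} (hC : IsCompact C) (hD : IsCompact D) :
    IsCompact {p : {p : Λ × Λ // G.s p.1 = G.r p.2} | p.1.1 ∈ C ∧ p.1.2 ∈ D} :=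
  G.isClosed_composable.isClosedEmbedding_subtypeVal.isCompact_preimage (hC.prod hD)

theorem isCompact_isComp {C D : Set Λ} (hC : IsCompact C) (hD : IsCompact D) :
    IsCompact {c | ∃ a ∈ C, ∃ b ∈ D, G.IsComp a b c} := by
  convert (G.isCompact_composable hC hD).image G.continuous_comp using 1
  ext c
  constructor
  · rintro ⟨a, ha, b, hb, h, rfl⟩
    exact ⟨_, ⟨ha, hb⟩, rfl⟩
  · rintro ⟨⟨p, h⟩, hp, rfl⟩
    exact ⟨p.1, hp.1, p.2, hp.2, h, rfl⟩

theorem IsRDProper.isCompact (hG : G.IsRDProper) {K : Set Λ₀} (hK : IsCompact K) (n : P) :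
    IsCompact {a | G.r a ∈ K ∧ G.d a = n} :=
  IsProperMap.isCompact_preimage hG (hK.prod (isCompact_singleton (x := n)))

/-- Extending the paths of a compact set by all paths of a fixed degree gives a compact set. -/
theorem IsRDProper.isCompact_extensions (hG : G.IsRDProper) {K : Set Λ} (hK : IsCompact K)
    (n : P) : IsCompact {c | ∃ a ∈ K, ∃ b, G.d b = n ∧ G.IsComp a b c} := by
  convert G.isCompact_isComp hK (hG.isCompact (hK.image G.continuous_s) n) using 1
  ext c
  constructor
  · rintro ⟨a, ha, b, hb, h⟩
    exact ⟨a, ha, b, ⟨⟨a, ha, h.s_eq_r⟩, hb⟩, h⟩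
  · rintro ⟨a, ha, b, hb, h⟩
    exact ⟨a, ha, b, hb.2, h⟩

/-- The set of paths of a fixed degree that can be prepended by an element of a compact set so
that the composite lies in another compact set. -/
theorem IsRDProper.isCompact_quotient (hG : G.IsRDProper) {C K : Set Λ} (hC : IsCompact C)
    (hK : IsCompact K) (n : P) :
    IsCompact {b | G.d b = n ∧ ∃ a ∈ C, ∃ c ∈ K, G.IsComp a b c} := by
  have h := (G.isCompact_composable hC (hG.isCompact (hC.image G.continuous_s) n)).inter_right
    (hK.isClosed.preimage G.continuous_comp)
  convert h.image (continuous_snd.comp continuous_subtype_val) using 1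
  ext b
  constructor
  · rintro ⟨hb, a, ha, c, hc, h, rfl⟩
    exact ⟨⟨(a, b), h⟩, ⟨⟨ha, ⟨a, ha, h⟩, hb⟩, hc⟩, rfl⟩
  · rintro ⟨⟨p, h⟩, ⟨⟨ha, -, hb⟩, hc⟩, rfl⟩
    exact ⟨hb, p.1, ha, _, hc, h, rfl⟩

/-! ## The path space -/

namespace PathSpace

instance : SetLike G.PathSpace Λ where
  coe A := A.toCloseds
  coe_injective _ _ h := Subtype.ext (SetLike.coe_injective h)

theorem nonempty (A : G.PathSpace) : (A : Set Λ).Nonempty := A.2.1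

theorem isHereditary (A : G.PathSpace) : G.IsHereditary (A : Set Λ) := A.2.2.1

theorem isDirectedSet (A : G.PathSpace) : G.IsDirectedSet (A : Set Λ) := A.2.2.2

theorem isInducing_toCloseds :
    @IsInducing _ _ _ (fellTopology Λ) (PathSpace.toCloseds (G := G)) :=
  let := fellTopology Λ
  ⟨rfl⟩

theorem isOpen_meets {U : Set Λ} (hU : IsOpen U) : IsOpen {A : G.PathSpace | ∃ a ∈ A, a ∈ U} :=
  let := fellTopology Λ
  (isOpen_fell_meets hU).preimage isInducing_toCloseds.continuous

theorem isOpen_disjoint {K : Set Λ} (hK : IsCompact K) :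
    IsOpen {A : G.PathSpace | ∀ a ∈ A, a ∉ K} := by
  let := fellTopology Λ
  convert (isOpen_fell_disjoint hK).preimage (isInducing_toCloseds (G := G)).continuous using 1
  ext A
  simp only [mem_ofPred_eq, mem_preimage, eq_empty_iff_forall_notMem, mem_inter_iff, not_and]
  rfl

theorem continuousAt_iff {Y : Type*} [TopologicalSpace Y] {f : Y → G.PathSpace} {y : Y} :
    ContinuousAt f y ↔
      (∀ K, IsCompact K → (∀ a ∈ f y, a ∉ K) → ∀ᶠ z in 𝓝 y, ∀ a ∈ f z, a ∉ K) ∧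
      (∀ U, IsOpen U → ∀ a ∈ f y, a ∈ U → ∀ᶠ z in 𝓝 y, ∃ a ∈ f z, a ∈ U) := by
  constructor
  · intro h
    exact ⟨fun K hK hy => h ((isOpen_disjoint hK).mem_nhds hy),
      fun U hU a ha haU => h ((isOpen_meets hU).mem_nhds ⟨a, ha, haU⟩)⟩
  · rintro ⟨h1, h2⟩
    let := fellTopology Λ
    rw [(isInducing_toCloseds (G := G)).continuousAt_iff, ContinuousAt, nhds_generateFrom]
    refine Filter.tendsto_iInf.2 fun S => Filter.tendsto_iInf.2 fun hS => Filter.tendsto_principal.2 ?_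
    obtain ⟨hy, ⟨K, hK, rfl⟩ | ⟨U, hU, rfl⟩⟩ := hS
    · filter_upwards [h1 K hK fun a ha haK => (Set.ext_iff.1 hy a).1 ⟨ha, haK⟩] with z hz
      exact eq_empty_iff_forall_notMem.2 fun a ha => hz a ha.1 ha.2
    · obtain ⟨a, ha, haU⟩ := hy
      exact h2 U hU a ha haU

end PathSpace

/-! ### Local compactness of the path space -/

/-- A failure of either property at `F` would be visible on a basic Fell neighbourhood, which
contains a hereditary directed set. Directedness is not local as stated, so it is replaced by two
local facts: uniqueness in each degree, and an element in the least upper bound degree. -/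
theorem isClosed_hereditary_directed [IsLeftCancelMul P] (hP : HasSemigroupLubs P)
    (hG : G.IsRDProper) : @IsClosed _ (fellTopology Λ)
      {F : Closeds Λ | G.IsHereditary (F : Set Λ) ∧ G.IsDirectedSet (F : Set Λ)} := by
  let := fellTopology Λ
  refine isClosed_of_closure_subset fun F hF => ?_
  rw [mem_closure_iff] at hF
  have hered : G.IsHereditary (F : Set Λ) := by
    intro a b hab hb
    by_contra ha
    obtain ⟨K, hK, haK, hKF⟩ := exists_compact_subset F.isClosed.isOpen_compl ha
    obtain ⟨F', ⟨h1, b', hb', a', ha', h⟩, h2, -⟩ := hF _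
      ((isOpen_fell_disjoint hK).inter
        (isOpen_fell_meets (G.isOpen_extensions (isOpen_interior (s := K)))))
      ⟨(disjoint_compl_right.mono_right hKF).inter_eq, b, hb, a, haK, hab⟩
    exact (Set.ext_iff.1 h1 a').1 ⟨h2 _ _ h hb', interior_subset ha'⟩
  have uniq : ∀ a ∈ F, ∀ b ∈ F, G.d a = G.d b → a = b := by
    intro a ha b hb hd
    by_contra hne
    obtain ⟨U, V, hU, hV, haU, hbV, hUV⟩ := t2_separation hne
    obtain ⟨F', ⟨⟨a', ha', haU', hda⟩, b', hb', hbV', hdb⟩, -, h⟩ := hF _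
      ((isOpen_fell_meets (hU.inter (G.isOpen_degree (G.d a)))).inter
        (isOpen_fell_meets (hV.inter (G.isOpen_degree (G.d a)))))
      ⟨⟨a, ha, haU, rfl⟩, b, hb, hbV, hd.symm⟩
    obtain rfl := h.eq_of_d_eq ha' hb' (Eq.trans hda (Eq.symm hdb))
    exact Set.disjoint_left.1 hUV haU' hbV'
  refine ⟨hered, fun a ha b hb => ?_⟩
  obtain ⟨l, hal, hbl, hl⟩ : ∃ l, SemigroupLE (G.d a) l ∧ SemigroupLE (G.d b) l ∧
      ∀ c, SemigroupLE (G.d a) c → SemigroupLE (G.d b) c → SemigroupLE l c := by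
    obtain ⟨F', ⟨⟨a', ha', hda⟩, b', hb', hdb⟩, -, h⟩ := hF _
      ((isOpen_fell_meets (G.isOpen_degree (G.d a))).inter
        (isOpen_fell_meets (G.isOpen_degree (G.d b)))) ⟨⟨a, ha, rfl⟩, b, hb, rfl⟩
    obtain ⟨c, -, hac, hbc⟩ := h a' ha' b' hb'
    rw [mem_ofPred_eq] at hda hdb
    exact hP _ _ ⟨G.d c, hda ▸ hac.d_le, hdb ▸ hbc.d_le⟩
  -- Otherwise `F` misses the paths of degree `l` with range in a compact neighbourhood of `r a`, a
  -- compact set by properness. Nearby hereditary directed sets also miss it, yet they contain such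
  -- a path, with the range of their element near `a`.
  obtain ⟨c, hc, hdc⟩ : ∃ c ∈ F, G.d c = l := by
    by_contra! hcon
    obtain ⟨K, hK, haK⟩ := exists_compact_mem_nhds (G.r a)
    obtain ⟨F', ⟨⟨h1, a', ha', hda, hra⟩, b', hb', hdb⟩, h2, h⟩ := hF _
      (((isOpen_fell_disjoint (hG.isCompact hK l)).inter
        (isOpen_fell_meets ((G.isOpen_degree (G.d a)).inter
          (isOpen_interior.preimage G.continuous_r)))).inter
        (isOpen_fell_meets (G.isOpen_degree (G.d b))))
      ⟨⟨eq_empty_iff_forall_notMem.2 fun c hc => hcon c hc.1 hc.2.2, a, ha, rfl,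
        mem_interior_iff_mem_nhds.2 haK⟩, b, hb, rfl⟩
    obtain ⟨c, hc, hac, hbc⟩ := h a' ha' b' hb'
    rw [mem_ofPred_eq] at hda hdb
    obtain ⟨x, hxc, hx⟩ := exists_pathLE_of_d_le (hl (G.d c) (hda ▸ hac.d_le) (hdb ▸ hbc.d_le))
    refine (Set.ext_iff.1 h1 x).1 ⟨h2 _ _ hxc hc, ?_, hx⟩
    rw [← hxc.r_eq, hac.r_eq]
    exact interior_subset hra
  have key : ∀ x ∈ F, SemigroupLE (G.d x) l → G.PathLE x c := by
    intro x hx hxl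
    obtain ⟨y, hyc, hy⟩ := exists_pathLE_of_d_le (hdc.symm ▸ hxl)
    rwa [uniq x hx y (hered _ _ hyc hc) hy.symm]
  exact ⟨c, hc, key a ha hal, key b hb hbl⟩

theorem pathSpace_t2Space : T2Space G.PathSpace :=
  let := fellTopology Λ
  have := fellTopology_t2Space Λ
  T2Space.of_injective_continuous (f := PathSpace.toCloseds) (fun _ _ h => Subtype.ext h)
    PathSpace.isInducing_toCloseds.continuous

theorem pathSpace_locallyCompactSpace [IsLeftCancelMul P] (hP : HasSemigroupLubs P)
    (hG : G.IsRDProper) : LocallyCompactSpace G.PathSpace := by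
  let := fellTopology Λ
  have := fellTopology_t2Space Λ
  have := fellTopology_compactSpace Λ
  refine PathSpace.isInducing_toCloseds.locallyCompactSpace ?_
  convert (isOpen_fell_meets isOpen_univ).isLocallyClosed.inter
    (isClosed_hereditary_directed hP hG).isLocallyClosed using 1
  ext F
  simp only [mem_inter_iff, mem_ofPred_eq, inter_univ]
  exact ⟨by rintro ⟨A, rfl⟩; exact A.2, fun h => ⟨⟨F, h⟩, rfl⟩⟩

/-! ## Prepending a path -/

namespace PathSpace

/-- The pairs of a path `a` and a point of `Ω` whose range is the source of `a`. -/
abbrev Composable (G : PGraph P Λ₀ Λ) : Type _ :=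
  {p : Λ × G.PathSpace // G.i (G.s p.1) ∈ p.2}

theorem s_eq_r_of_mem (B : G.PathSpace) {a b : Λ} (ha : G.i (G.s a) ∈ B) (hb : b ∈ B) :
    G.s a = G.r b := by
  have := B.isDirectedSet.r_eq ha hb
  rwa [G.r_i] at this

/-- Since `s` is open, every point of the path space near `B` still has its range among the sources
of paths near `a`. -/
theorem isOpenMap_snd_composable : IsOpenMap fun p : Composable G => p.1.2 := by
  rw [IsOpenMap.eq_1]
  intro O hO
  obtain ⟨O', hO', rfl⟩ := isOpen_induced_iff.1 hO
  rw [isOpen_iff_mem_nhds]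
  rintro _ ⟨⟨⟨a, B⟩, h⟩, hp, rfl⟩
  obtain ⟨W, V, hW, hV, haW, hBV, hWV⟩ := isOpen_prod_iff.1 hO' a B hp
  have hopen : IsOpen (G.r ⁻¹' (G.s '' W)) :=
    (G.isLocalHomeomorph_s.isOpenMap _ hW).preimage G.continuous_r
  filter_upwards [hV.mem_nhds hBV, (isOpen_meets hopen).mem_nhds
    ⟨_, h, a, haW, (G.r_i _).symm⟩] with B' hB' hB''
  obtain ⟨b, hb, a', ha', hab⟩ := hB''
  exact ⟨⟨(a', B'), hab.symm ▸ B'.isHereditary.id_mem hb⟩, hWV ⟨ha', hB'⟩, rfl⟩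

/-- The points of `Ω` that can be shifted by `n`. -/
def shiftDomain (G : PGraph P Λ₀ Λ) (n : P) : Set G.PathSpace :=
  {A | (G.shift (A : Set Λ) n).Nonempty}

theorem mem_shiftDomain_iff {A : G.PathSpace} {n : P} :
    A ∈ shiftDomain G n ↔ ∃ a ∈ A, G.d a = n := A.isHereditary.shift_nonempty_iff

theorem isOpen_shiftDomain (n : P) : IsOpen (shiftDomain G n) := by
  convert isOpen_meets (G.isOpen_degree n) using 1
  ext A
  exact mem_shiftDomain_iff

variable [IsLeftCancelMul P]

/-- The point of `Ω` generated by the composites of a path with the elements of a point of `Ω`. -/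
def prepend (p : Composable G) : G.PathSpace :=
  ⟨⟨G.prepend p.1.1 p.1.2, (isDirectedSet_prepend _ p.1.2.isDirectedSet).isClosed⟩,
    ⟨_, mem_prepend_self p.2⟩, isHereditary_prepend _ _,
    isDirectedSet_prepend _ p.1.2.isDirectedSet⟩

theorem mem_prepend {p : Composable G} {x : Λ} :
    x ∈ prepend p ↔ ∃ b ∈ p.1.2, ∃ c, G.IsComp p.1.1 b c ∧ G.PathLE x c := Iff.rfl

/-- The elements of degree `m` in `prepend (a, B)` are determined by the element of `B` of degree
`p`, where `d(a) p` is the least upper bound of `d(a)` and `m`. -/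
theorem exists_of_mem_prepend {p : Composable G} {x : Λ} (hx : x ∈ prepend p) {l k q : P}
    (hk : l = G.d p.1.1 * k) (hq : l = G.d x * q)
    (hl : ∀ c : P, SemigroupLE (G.d p.1.1) c → SemigroupLE (G.d x) c → SemigroupLE l c) :
    ∃ b ∈ p.1.2, G.d b = k ∧ ∃ y c, G.d y = q ∧ G.IsComp x y c ∧ G.IsComp p.1.1 b c := by
  obtain ⟨b, hb, c, hc, hxc⟩ := hx
  obtain ⟨z, hzc, hz⟩ := exists_pathLE_of_d_le (hl _ hc.pathLE.d_le hxc.d_le)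
  obtain ⟨y, hy⟩ := pathLE_iff.1 (hxc.of_d_le hzc ⟨q, hz.trans hq⟩)
  obtain ⟨b', hb'⟩ := pathLE_iff.1 (hc.pathLE.of_d_le hzc ⟨k, hz.trans hk⟩)
  refine ⟨b', p.1.2.isHereditary _ _ ((isComp_pathLE_iff hb' hc).1 hzc) hb, ?_, y, z, ?_, hy, hb'⟩
  · exact mul_left_cancel (hb'.d_eq.symm.trans (hz.trans hk))
  · exact mul_left_cancel (hy.d_eq.symm.trans (hz.trans hq))

/-- For avoidance of a compact `K`, elements of the generated set of degree `m` are extended to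
degree `l`, the least upper bound of `m` and `d a`. Lying in `K` then forces an element of `B` into
a compact set, and avoiding that set is an open condition on `B`. -/
theorem continuous_prepend (hP : HasSemigroupLubs P) (hG : G.IsRDProper) :
    Continuous (prepend (G := G)) := by
  refine continuous_iff_continuousAt.2 fun p => continuousAt_iff.2 ⟨fun K hK hpK => ?_, ?_⟩
  · have hfst : Continuous fun p : Composable G => p.1.1 :=
      continuous_fst.comp continuous_subtype_val
    have hsnd : Continuous fun p : Composable G => p.1.2 :=
      continuous_snd.comp continuous_subtype_val
    have hdeg : ∀ᶠ p' in 𝓝 p, G.d p'.1.1 = G.d p.1.1 :=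
      ((G.isOpen_degree _).preimage hfst).mem_nhds rfl
    have key : ∀ m : P, ∀ᶠ p' in 𝓝 p, ∀ x ∈ prepend p', G.d x = m → x ∉ K := by
      intro m
      by_cases hm : ∃ c, SemigroupLE (G.d p.1.1) c ∧ SemigroupLE m c
      · obtain ⟨l, ⟨k, hk⟩, ⟨q, hq⟩, hl⟩ := hP _ _ hm
        -- The compact neighbourhood `C` is taken where `s` is injective, so that at the limit point
        -- the only path in `C` composable with elements of `p.1.2` is `p.1.1` itself.
        obtain ⟨e, hpe, he⟩ := G.isLocalHomeomorph_s p.1.1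
        obtain ⟨C, hC, hpC, hCe⟩ := exists_compact_subset e.open_source hpe
        have hL := hG.isCompact_quotient hC (hG.isCompact_extensions hK q) k
        have hpL : ∀ b ∈ p.1.2, b ∉ {b | G.d b = k ∧ ∃ a ∈ C,
            ∃ c ∈ {c | ∃ a ∈ K, ∃ b, G.d b = q ∧ G.IsComp a b c}, G.IsComp a b c} := by
          rintro b hb ⟨-, a, ha, c, ⟨x, hx, y, -, hxy⟩, hab⟩
          obtain rfl : a = p.1.1 := by
            refine e.injOn (hCe ha) hpe ?_
            rw [← he, hab.s_eq_r, p.1.2.s_eq_r_of_mem p.2 hb]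
          exact hpK x (mem_prepend.2 ⟨b, hb, c, hab, hxy.pathLE⟩) hx
        filter_upwards [hdeg, hfst.continuousAt (isOpen_interior.mem_nhds hpC),
          hsnd.continuousAt ((isOpen_disjoint hL).mem_nhds hpL)] with p' hd hpC' hpL' x hx hxm hxK
        rw [← hd] at hk hl
        rw [← hxm] at hq hl
        obtain ⟨b, hb, hbk, y, c, hy, hxy, hc⟩ := exists_of_mem_prepend hx hk hq hl
        exact hpL' b hb ⟨hbk, p'.1.1, interior_subset hpC', c, ⟨x, hxK, y, hy, hxy⟩, hc⟩
      · filter_upwards [hdeg] with p' hd x hx hxm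
        obtain ⟨b, -, c, hc, hxc⟩ := mem_prepend.1 hx
        exact absurd ⟨G.d c, hd ▸ hc.pathLE.d_le, hxm ▸ hxc.d_le⟩ hm
    -- A compact set involves only finitely many degrees, so the neighbourhoods found degree by
    -- degree can be intersected.
    have hfin : (G.d '' K).Finite := (hK.image G.continuous_d).finite_of_discrete
    filter_upwards [(Filter.eventually_all_finite hfin).2 fun m _ => key m] with p' h x hx hxK
    exact h _ ⟨x, hxK, rfl⟩ x hx rfl hxK
  · rintro U hU x ⟨b, hb, c, hc, hxc⟩ hxU
    obtain ⟨hab, rfl⟩ := hc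
    obtain ⟨O, hO, hOeq⟩ :=
      isOpen_induced_iff.1 ((G.isOpen_extensions hU).preimage G.continuous_comp)
    have hO' : ∀ q (h : G.s q.1 = G.r q.2), q ∈ O ↔ ∃ a ∈ U, G.PathLE a (G.comp ⟨q, h⟩) :=
      fun q h => Set.ext_iff.1 hOeq ⟨q, h⟩
    obtain ⟨W, V, hW, hV, haW, hbV, hWV⟩ :=
      isOpen_prod_iff.1 hO p.1.1 b ((hO' _ hab).2 ⟨x, hxU, hxc⟩)
    filter_upwards [(hW.preimage (continuous_fst.comp continuous_subtype_val)).mem_nhds haW,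
      ((isOpen_meets hV).preimage (continuous_snd.comp continuous_subtype_val)).mem_nhds
        ⟨b, hb, hbV⟩] with p' hW' hV'
    obtain ⟨b', hb', hbV'⟩ := hV'
    have h := p'.1.2.s_eq_r_of_mem p'.2 hb'
    obtain ⟨x', hx', hle⟩ := (hO' (p'.1.1, b') h).1 (hWV ⟨hW', hbV'⟩)
    exact ⟨x', mem_prepend.2 ⟨b', hb', _, ⟨h, rfl⟩, hle⟩, hx'⟩

/-! ## The shift -/

/-- The shift `A ↦ A · n` on its domain. -/
def shift (n : P) (A : shiftDomain G n) : G.PathSpace :=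
  ⟨⟨G.shift A.1 n, (A.1.isDirectedSet.shift A.1.isHereditary n).isClosed⟩, A.2,
    A.1.isHereditary.shift n, A.1.isDirectedSet.shift A.1.isHereditary n⟩

theorem shiftDomain_mul_iff {A : G.PathSpace} {m n : P} : A ∈ shiftDomain G (m * n) ↔
    ∃ h : A ∈ shiftDomain G m, shift m ⟨A, h⟩ ∈ shiftDomain G n := by
  have h : ∀ h : A ∈ shiftDomain G m,
      shift m ⟨A, h⟩ ∈ shiftDomain G n ↔ A ∈ shiftDomain G (m * n) := by
    intro h
    change (G.shift (G.shift A m) n).Nonempty ↔ (G.shift A (m * n)).Nonempty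
    rw [shift_shift]
  constructor
  · intro hA
    obtain ⟨c, hc, hd⟩ := mem_shiftDomain_iff.1 hA
    obtain ⟨a, ha, had⟩ := exists_pathLE_of_d_le ⟨n, hd⟩
    have := mem_shiftDomain_iff.2 ⟨a, A.isHereditary _ _ ha hc, had⟩
    exact ⟨this, (h this).2 hA⟩
  · rintro ⟨h1, h2⟩
    exact (h h1).1 h2

/-- The action of `P` on `Ω` by the shift. -/
def action (G : PGraph P Λ₀ Λ) : PartialSemigroupAction G.PathSpace P where
  dom := {p | p.1 ∈ shiftDomain G p.2}
  act p := shift p.1.2 ⟨p.1.1, p.2⟩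
  one_mem A := by
    change (G.shift (A : Set Λ) 1).Nonempty
    rw [shift_one]
    exact A.nonempty
  act_one A := SetLike.coe_injective (shift_one (A : Set Λ))
  mul_mem_iff _ _ _ := shiftDomain_mul_iff
  act_mul _ m n _ _ _ := SetLike.coe_injective (shift_shift m n)

/-- By heredity, an element of some degree yields elements of all smaller degrees; by directedness,
elements of degrees `m` and `n` have a common extension, whose degree dominates the least upper
bound. -/
theorem isDirected_action (hP : HasSemigroupLubs P) : (action G).IsDirected := by
  intro m n hmn
  have hU : ∀ k, (action G).U k = shiftDomain G k := fun _ => rfl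
  simp only [hU] at hmn ⊢
  have key : ∀ A ∈ shiftDomain G m ∩ shiftDomain G n,
      ∃ c ∈ A, SemigroupLE m (G.d c) ∧ SemigroupLE n (G.d c) := by
    rintro A ⟨hm, hn⟩
    obtain ⟨a, ha, rfl⟩ := mem_shiftDomain_iff.1 hm
    obtain ⟨b, hb, rfl⟩ := mem_shiftDomain_iff.1 hn
    obtain ⟨c, hc, hac, hbc⟩ := A.isDirectedSet a ha b hb
    exact ⟨c, hc, hac.d_le, hbc.d_le⟩
  have mono : ∀ {A : G.PathSpace} {c : Λ} {k : P}, c ∈ A → SemigroupLE k (G.d c) →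
      A ∈ shiftDomain G k := by
    intro A c k hc hk
    obtain ⟨a, ha, hd⟩ := exists_pathLE_of_d_le hk
    exact mem_shiftDomain_iff.2 ⟨a, A.isHereditary _ _ ha hc, hd⟩
  obtain ⟨A, hA⟩ := hmn
  obtain ⟨c, -, hc⟩ := key A hA
  obtain ⟨l, hml, hnl, hl⟩ := hP m n ⟨_, hc⟩
  refine ⟨l, hml, hnl, Subset.antisymm (fun B hB => ?_) fun B hB => ?_⟩
  · obtain ⟨b, hb, hmb, hnb⟩ := key B hB
    exact mono hb (hl _ hmb hnb)
  · obtain ⟨b, hb, rfl⟩ := mem_shiftDomain_iff.1 hB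
    exact ⟨mono hb hml, mono hb hnl⟩

theorem continuous_shift (n : P) : Continuous (shift (G := G) n) := by
  refine continuous_iff_continuousAt.2 fun A => continuousAt_iff.2 ⟨fun K hK hAK => ?_, ?_⟩
  · obtain ⟨a, ha, hd⟩ := mem_shiftDomain_iff.1 A.2
    -- A nearby `A'` has its unique element of degree `n` in `C`, so if it misses the compact set of
    -- composites of `C` with `K`, its shift misses `K`.
    obtain ⟨C, hC, haC, hCn⟩ := exists_compact_subset (G.isOpen_degree n) hd
    have hA : ∀ x ∈ A.1, x ∉ {c | ∃ a ∈ C, ∃ b ∈ K, G.IsComp a b c} := by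
      rintro x hx ⟨a', ha', b, hb, h⟩
      exact hAK b (mem_shift_iff.2 ⟨a', x, h, hCn ha', hx⟩) hb
    filter_upwards [((isOpen_disjoint (G.isCompact_isComp hC hK)).preimage
      continuous_subtype_val).mem_nhds hA, ((isOpen_meets isOpen_interior).preimage
      continuous_subtype_val).mem_nhds ⟨a, ha, haC⟩] with A' h1 h2 b hb hbK
    obtain ⟨a', ha', haC'⟩ := h2
    obtain ⟨a'', c, h, hd', hc⟩ := mem_shift_iff.1 hb
    obtain rfl : a'' = a' := A'.1.isDirectedSet.eq_of_d_eq
      (A'.1.isHereditary _ _ h.pathLE hc) ha' (hd'.trans (hCn (interior_subset haC')).symm)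
    exact h1 c hc ⟨a'', interior_subset haC', b, hbK, h⟩
  · intro U hU b hb hbU
    obtain ⟨a, c, h, hd, hc⟩ := mem_shift_iff.1 hb
    filter_upwards [((isOpen_meets (G.isOpen_isComp (G.isOpen_degree n) hU)).preimage
      continuous_subtype_val).mem_nhds ⟨c, hc, a, hd, b, hbU, h⟩] with A' hA'
    obtain ⟨c', hc', a', hd', b', hb', h'⟩ := hA'
    exact ⟨b', mem_shift_iff.2 ⟨a', c', h', hd', hc'⟩, hb'⟩

/-! ### The shift is open and locally injective -/

theorem shift_prepend (p : Composable G) (h : prepend p ∈ shiftDomain G (G.d p.1.1)) :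
    shift (G.d p.1.1) ⟨prepend p, h⟩ = p.1.2 :=
  SetLike.coe_injective (PGraph.shift_prepend p.1.2.isHereditary p.1.2.isDirectedSet p.2)

theorem prepend_shift {a : Λ} (A : shiftDomain G (G.d a)) (ha : a ∈ A.1) :
    prepend ⟨(a, shift _ A), id_mem_shift A.1.isHereditary A.1.isDirectedSet ha⟩ = A.1 :=
  SetLike.coe_injective (PGraph.prepend_shift A.1.isHereditary A.1.isDirectedSet ha)

theorem prepend_mem_shiftDomain (p : Composable G) : prepend p ∈ shiftDomain G (G.d p.1.1) :=
  mem_shiftDomain_iff.2 ⟨_, mem_prepend_self p.2, rfl⟩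

/-- The image of an open set is the projection to `B` of the pairs `(a, B)` with `d a = n` whose
prepended set lies in it; these pairs form an open set by continuity of prepending, and the
projection is open. -/
theorem isOpenMap_shift (hP : HasSemigroupLubs P) (hG : G.IsRDProper) (n : P) :
    IsOpenMap (shift (G := G) n) := by
  intro O hO
  obtain ⟨O', hO', rfl⟩ := isOpen_induced_iff.1 hO
  convert isOpenMap_snd_composable _ ((hO'.preimage (continuous_prepend hP hG)).inter
    ((G.isOpen_degree n).preimage (continuous_fst.comp continuous_subtype_val))) using 1
  ext B
  constructor
  · rintro ⟨A, hA, rfl⟩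
    obtain ⟨a, ha, rfl⟩ := mem_shiftDomain_iff.1 A.2
    refine ⟨⟨(a, shift _ A), id_mem_shift A.1.isHereditary A.1.isDirectedSet ha⟩, ⟨?_, rfl⟩, rfl⟩
    rwa [mem_preimage, prepend_shift A ha]
  · rintro ⟨p, ⟨hp, rfl⟩, rfl⟩
    exact ⟨⟨prepend p, prepend_mem_shiftDomain p⟩, hp, shift_prepend p _⟩

/-- The shifted set determines the source of the removed path. Where `s` is injective this recovers
the path, and prepending it recovers the original set. -/
theorem exists_injOn_shift (n : P) (A : shiftDomain G n) :
    ∃ O ∈ 𝓝 A, IsOpen O ∧ InjOn (shift (G := G) n) O := by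
  obtain ⟨a, ha, hd⟩ := mem_shiftDomain_iff.1 A.2
  obtain ⟨e, hae, he⟩ := G.isLocalHomeomorph_s a
  have hO := (isOpen_meets (G := G) (e.open_source.inter (G.isOpen_degree n))).preimage
    (continuous_subtype_val (p := (· ∈ shiftDomain G n)))
  refine ⟨_, hO.mem_nhds ⟨a, ha, hae, hd⟩, hO, ?_⟩
  rintro B ⟨b, hb, hbe, rfl⟩ B' ⟨b', hb', hbe', hd'⟩ h
  have hb1 := id_mem_shift B.1.isHereditary B.1.isDirectedSet hb
  have hb2 : G.i (G.s b') ∈ shift (G.d b) B' := by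
    have := id_mem_shift B'.1.isHereditary B'.1.isDirectedSet hb'
    rwa [hd'] at this
  obtain rfl : b = b' := by
    refine e.injOn hbe hbe' ?_
    have := (shift (G.d b) B').s_eq_r_of_mem hb2 (h ▸ hb1 : G.i (G.s b) ∈ _)
    rw [← he, this, G.r_i]
  refine Subtype.ext ?_
  rw [← prepend_shift B hb, ← prepend_shift B' hb']
  congr 3

theorem byPartialLocalHomeomorphisms_action (hP : HasSemigroupLubs P) (hG : G.IsRDProper) :
    (action G).ByPartialLocalHomeomorphisms where
  isOpen_U n := isOpen_shiftDomain n
  isOpen_V n := (isOpenMap_shift hP hG n).isOpen_range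
  isLocalHomeomorph n := by
    rw [isLocalHomeomorph_iff_isOpenEmbedding_restrict]
    intro A
    obtain ⟨O, hAO, hO, hinj⟩ := exists_injOn_shift n A
    refine ⟨O, hAO, .of_continuous_injective_isOpenMap ?_ ?_ ?_⟩
    · exact ((continuous_shift n).comp continuous_subtype_val).subtype_mk _
    · intro B B' h
      exact Subtype.ext (hinj B.2 B'.2 (congrArg Subtype.val h))
    · exact ((isOpenMap_shift hP hG n).comp hO.isOpenMap_subtype_val).subtype_mk _

end PathSpace

end PGraph

theorem mainTheorem9 {Q Λ₀ Λ : Type*} [Group Q] [TopologicalSpace Q] [DiscreteTopology Q]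
    [TopologicalSpace Λ₀] [LocallyCompactSpace Λ₀] [T2Space Λ₀]
    [TopologicalSpace Λ] [LocallyCompactSpace Λ] [T2Space Λ]
    (P : Submonoid Q) (hP : IsQuasiLatticeOrdered P)
    (G : PGraph P Λ₀ Λ) (hG : G.IsRDProper) :
    LocallyCompactSpace G.PathSpace ∧ T2Space G.PathSpace ∧
    ∃ T : PartialSemigroupAction G.PathSpace P,
      T.dom = {p : G.PathSpace × P | (G.shift (p.1.toCloseds : Set Λ) p.2).Nonempty} ∧
      (∀ p : T.dom, ((T.act p).toCloseds : Set Λ) = G.shift (p.1.1.toCloseds : Set Λ) p.1.2) ∧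
      T.IsDirected ∧ T.ByPartialLocalHomeomorphisms :=
  ⟨PGraph.pathSpace_locallyCompactSpace hP.exists_lub hG, PGraph.pathSpace_t2Space,
    PGraph.PathSpace.action G, rfl, fun _ => rfl, PGraph.PathSpace.isDirected_action hP.exists_lub,
    PGraph.PathSpace.byPartialLocalHomeomorphisms_action hP.exists_lub hG⟩
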